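/- **Theorem 3 (R(D)).** Let $\sigma>0$. For $\alpha,\beta>0$ with $\alpha\beta>1$ put $\gamma=\sqrt{\alpha/\beta}$, $\delta=\operatorname{arccoth}(\alpha\beta)$, $\rho=e^{-\delta}$, and consider the nonstationary zero-mean Gaussian process $$X(t)=\sum_{k=0}^\infty X_k\,(D_\gamma\psi_k)(t),\qquad t\in\mathbb R,$$ where $(D_\gamma\psi_k)(t)=\gamma^{-1/2}\psi_k(t/\gamma)$ is the dilated $k$th Hermite function, $\psi_k(t)=(2^kk!\sqrt\pi)^{-1/2}H_k(t)e^{-t^2/2}$, $H_k(t)=e^{t^2}(-d/dt)^ke^{-t^2}$, and the coefficients $X_k\sim\mathcal N(0,\sigma^2\rho^{2k+1})$, $k=0,1,\ldots$, are independent. The process is represented by its coefficient sequence $\boldsymbol X=(X_0,X_1,\ldots)$, and its rate distortion function (in nats) is $$R(D)=\inf\Bigl\{I(\boldsymbol X;\hat{\boldsymbol X}) : \mathbb E\sum_{k=0}^\infty (X_k-\hat X_k)^2\le D\Bigr\},$$ the infimum of the mutual information being over all random sequences $\hat{\boldsymbol X}=(\hat X_0,\hat X_1,\ldots)$ of real numbers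 jointly distributed with $\boldsymbol X$. For functions $A,B$ of $x>1$ write $A\doteq B$ if $(A(x)-B(x))/x\to0$ as $x\to\infty$. Let $w_{-1}:(0,1]\to[0,\infty)$ be the inverse function of $y\mapsto(2y+1)e^{-2y}$, $y\ge0$; equivalently $w_{-1}(x)=\frac12[-1-W_{-1}(-x/e)]$, where $W_{-1}$ is the branch of the Lambert $W$ function with values in $(-\infty,-1]$. Let $D=D(\alpha\beta)$ depend on $\alpha\beta$ in such a way that $D(\alpha\beta)=\Omega(\alpha\beta)$, i.e. $\liminf_{\alpha\beta\to\infty}D(\alpha\beta)/(\alpha\beta)>0$. Then $R(D)$ is finite for all sufficiently large $\alpha\beta$ and, as functions of $x=\alpha\beta$, $$R(D)\doteq\begin{cases}\dfrac{\alpha\beta}{2}\left[w_{-1}\!\left(\dfrac{D}{(\alpha\beta/2)\sigma^2}\right)\right]^2 & \text{if } D\le(\alpha\beta/2)\sigma^2,\\[2mm] 0 & \text{otherwise,}\end{cases}$$ where the right-hand side is the function defined by these cases for each value of $\alpha\beta$. -/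

import Mathlib

open MeasureTheory ProbabilityTheory InformationTheory Filter Topology
open scoped ENNReal

noncomputable section

/-! ### The parameters of the process -/

/-- The inverse hyperbolic cotangent `arccoth x`, for `x > 1`. -/
def arcoth (x : ℝ) : ℝ := (1 / 2) * Real.log ((x + 1) / (x - 1))

/-- For `x > 1`, `arcoth x` is the positive number whose hyperbolic cotangent is `x`. -/
theorem arcoth_spec {x : ℝ} (hx : 1 < x) :
    0 < arcoth x ∧ Real.cosh (arcoth x) / Real.sinh (arcoth x) = x := by
  have h1 : 0 < x - 1 := by linarith
  have h2 : 0 < x + 1 := by linarith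
  have hq : 1 < (x + 1) / (x - 1) := by rw [lt_div_iff₀ h1]; linarith
  have hpos : 0 < arcoth x := by
    have := Real.log_pos hq
    unfold arcoth; linarith
  refine ⟨hpos, ?_⟩
  have hs : 0 < Real.sinh (arcoth x) := Real.sinh_pos_iff.2 hpos
  have he : Real.exp (arcoth x) * Real.exp (arcoth x) = (x + 1) / (x - 1) := by
    rw [← Real.exp_add, show arcoth x + arcoth x = Real.log ((x + 1) / (x - 1)) by
      unfold arcoth; ring, Real.exp_log (by linarith)]
  rw [div_eq_iff hs.ne', Real.cosh_eq, Real.sinh_eq, Real.exp_neg]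
  have hE := Real.exp_pos (arcoth x)
  rw [eq_div_iff h1.ne'] at he
  field_simp
  nlinarith

/-- The parameter `ρ = exp (-δ)`, where `δ = arccoth (α β)`, as a function of `α β`. -/
def rho (x : ℝ) : ℝ := Real.exp (-arcoth x)

/-! ### Dilated Hermite functions and the Gaussian process -/

/-- The physicists' Hermite polynomial `H_k(t) = exp(t²) (-d/dt)^k exp(-t²)`. -/
def hermitePoly (k : ℕ) (t : ℝ) : ℝ :=
  Real.exp (t ^ 2) * ((-1) ^ k * iteratedDeriv k (fun s : ℝ => Real.exp (-s ^ 2)) t)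

/-- The `k`th Hermite function `ψ_k(t) = (2^k k! √π)^(-1/2) H_k(t) exp(-t²/2)`. -/
def hermiteFun (k : ℕ) (t : ℝ) : ℝ :=
  (Real.sqrt (2 ^ k * (Nat.factorial k : ℝ) * Real.sqrt Real.pi))⁻¹ * hermitePoly k t *
    Real.exp (-t ^ 2 / 2)

/-- The dilated Hermite function `(D_γ ψ_k)(t) = γ^(-1/2) ψ_k(t/γ)`. -/
def dilatedHermite (γ : ℝ) (k : ℕ) (t : ℝ) : ℝ :=
  (Real.sqrt γ)⁻¹ * hermiteFun k (t / γ)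

/-- `X` is the zero-mean Gaussian process `X(t) = ∑ₖ ξₖ (D_γ ψₖ)(t)`, `γ = √(α/β)`, with
independent coefficients `ξₖ ∼ 𝒩(0, σ² ρ^(2k+1))`, `ρ = exp (-arccoth (α β))`. -/
structure IsHermiteGaussianProcess {Ω : Type*} [MeasurableSpace Ω] (P : Measure Ω)
    (σ α β : ℝ) (ξ : ℕ → Ω → ℝ) (X : ℝ → Ω → ℝ) : Prop where
  indep : iIndepFun ξ P
  law : ∀ k, HasLaw (ξ k) (gaussianReal 0 (Real.toNNReal (σ ^ 2 * rho (α * β) ^ (2 * k + 1)))) P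
  expansion : ∀ t, ∀ᵐ ω ∂P, X t ω = ∑' k, ξ k ω * dilatedHermite (Real.sqrt (α / β)) k t

/-! ### The rate distortion function -/

/-- The mutual information, in nats, of a pair of random variables with joint law `π`: the
divergence of the joint law from the product of its marginals. -/
def mutualInfo {A B : Type*} [MeasurableSpace A] [MeasurableSpace B] (π : Measure (A × B)) :
    ℝ≥0∞ :=
  klDiv π (π.fst.prod π.snd)

/-- The mean-square error `𝔼 ∑ₖ (xₖ - yₖ)²` of two random sequences with joint law `π`. -/
def meanSquareError (π : Measure ((ℕ → ℝ) × (ℕ → ℝ))) : ℝ≥0∞ :=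
  ∫⁻ p, ∑' k, ENNReal.ofReal ((p.1 k - p.2 k) ^ 2) ∂π

/-- The rate distortion function, in nats, of a random sequence with law `μ`: the infimum of the
mutual information of the sequence and its estimate, over all joint laws of the sequence with an
estimate whose mean-square error is at most `D`. -/
def rateDistortion (μ : Measure (ℕ → ℝ)) (D : ℝ) : ℝ≥0∞ :=
  ⨅ (π : Measure ((ℕ → ℝ) × (ℕ → ℝ))) (_ : π.fst = μ)
    (_ : meanSquareError π ≤ ENNReal.ofReal D), mutualInfo π

/-! ### Asymptotic notions -/

/-- `A ≐ B`: `(A(x) - B(x)) / x → 0` as `x → ∞`. -/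
def AsympEq (A B : ℝ → ℝ) : Prop :=
  Tendsto (fun x => (A x - B x) / x) atTop (𝓝 0)

/-- `A(x) = Ω(B(x))` as `x → ∞`: `B > 0` on `(1, ∞)` and `liminf A(x)/B(x) > 0`. -/
def IsBigOmega (A B : ℝ → ℝ) : Prop :=
  (∀ x, 1 < x → 0 < B x) ∧ 0 < liminf (fun x => ((A x / B x : ℝ) : EReal)) atTop

/-! ### The function `w₋₁` -/

/-- The function `(2 y + 1) exp (-2 y)`. -/
def wBase (y : ℝ) : ℝ := (2 * y + 1) * Real.exp (-(2 * y))

/-- The function `w₋₁` on `(0, 1]`: the inverse of `y ↦ (2 y + 1) exp (-2 y)`, `y ≥ 0`. -/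
def wNegOne (x : ℝ) : ℝ := Function.invFunOn wBase (Set.Ici 0) x

theorem wBase_strictAntiOn : StrictAntiOn wBase (Set.Ici 0) := by
  have hd : ∀ y, HasDerivAt wBase (-(4 * y) * Real.exp (-(2 * y))) y := by
    intro y
    have h1 : HasDerivAt (fun y : ℝ => 2 * y + 1) (2 * 1) y :=
      ((hasDerivAt_id y).const_mul 2).add_const 1
    have h2 : HasDerivAt (fun y : ℝ => Real.exp (-(2 * y)))
        (Real.exp (-(2 * y)) * (-(2 * 1))) y :=
      (((hasDerivAt_id y).const_mul 2).neg).exp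
    have h3 := h1.mul h2
    have h4 : 2 * 1 * Real.exp (-(2 * y)) + (2 * y + 1) * (Real.exp (-(2 * y)) * (-(2 * 1))) =
        -(4 * y) * Real.exp (-(2 * y)) := by ring
    rw [h4] at h3
    exact h3
  apply strictAntiOn_of_deriv_neg (convex_Ici 0)
  · exact fun y _ => (hd y).continuousAt.continuousWithinAt
  · intro y hy
    rw [interior_Ici, Set.mem_Ioi] at hy
    rw [(hd y).deriv]
    have := Real.exp_pos (-(2 * y))
    nlinarith [mul_pos hy this]

theorem wBase_image : wBase '' Set.Ici 0 = Set.Ioc 0 1 := by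
  ext x
  constructor
  · rintro ⟨y, hy, rfl⟩
    rw [Set.mem_Ici] at hy
    refine ⟨by unfold wBase; positivity, ?_⟩
    have h := wBase_strictAntiOn.antitoneOn (Set.mem_Ici.2 le_rfl) (Set.mem_Ici.2 hy) hy
    simpa [wBase] using h
  · rintro ⟨h0, h1⟩
    have hlim : Tendsto wBase atTop (𝓝 0) := by
      have h2 : Tendsto (fun y : ℝ => 2 * y) atTop atTop :=
        tendsto_id.const_mul_atTop (by norm_num)
      have h3 := (Real.tendsto_pow_mul_exp_neg_atTop_nhds_zero 1).comp h2
      have h4 := (Real.tendsto_pow_mul_exp_neg_atTop_nhds_zero 0).comp h2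
      have h5 := h3.add h4
      simp only [add_zero] at h5
      refine h5.congr fun y => ?_
      simp only [Function.comp, wBase, pow_one, pow_zero]
      ring
    obtain ⟨b, hb, hb0⟩ := ((hlim.eventually (gt_mem_nhds h0)).and (eventually_ge_atTop 0)).exists
    have hc : ContinuousOn wBase (Set.Icc 0 b) := by unfold wBase; fun_prop
    obtain ⟨y, hy, hyx⟩ := intermediate_value_Icc' hb0 hc
      ⟨hb.le, by simpa [wBase] using h1⟩
    exact ⟨y, hy.1, hyx⟩

theorem wNegOne_spec {x : ℝ} (hx : x ∈ Set.Ioc (0 : ℝ) 1) :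
    0 ≤ wNegOne x ∧ (2 * wNegOne x + 1) * Real.exp (-(2 * wNegOne x)) = x := by
  rw [← wBase_image] at hx
  exact ⟨Function.invFunOn_mem hx, Function.invFunOn_eq hx⟩

theorem wNegOne_wBase {y : ℝ} (hy : 0 ≤ y) : wNegOne (wBase y) = y :=
  wBase_strictAntiOn.injOn.leftInvOn_invFunOn hy

/-- The branch `W₋₁` of the Lambert `W` function on `[-1/e, 0)`: the inverse of `w ↦ w exp w`,
`w ≤ -1`. -/
def lambertWNegOne (x : ℝ) : ℝ :=
  Function.invFunOn (fun w : ℝ => w * Real.exp w) (Set.Iic (-1)) x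

/-- `w₋₁(x) = (-1 - W₋₁(-x/e)) / 2` for `0 < x ≤ 1`. -/
theorem wNegOne_eq_lambert {x : ℝ} (hx : x ∈ Set.Ioc (0 : ℝ) 1) :
    wNegOne x = (1 / 2) * (-1 - lambertWNegOne (-x / Real.exp 1)) := by
  have key : ∀ y : ℝ, (-1 - 2 * y) * Real.exp (-1 - 2 * y) = -wBase y / Real.exp 1 := by
    intro y
    rw [show -1 - 2 * y = -(2 * y) - 1 by ring, Real.exp_sub, wBase]
    ring
  obtain ⟨h0, h1⟩ := wNegOne_spec hx
  have hex : ∃ w ∈ Set.Iic (-1 : ℝ), w * Real.exp w = -x / Real.exp 1 := by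
    refine ⟨-1 - 2 * wNegOne x, by rw [Set.mem_Iic]; linarith, ?_⟩
    rw [key, wBase, h1]
  have hm : lambertWNegOne (-x / Real.exp 1) ≤ -1 :=
    Function.invFunOn_mem (f := fun w : ℝ => w * Real.exp w) hex
  have he : lambertWNegOne (-x / Real.exp 1) * Real.exp (lambertWNegOne (-x / Real.exp 1)) =
      -x / Real.exp 1 := Function.invFunOn_eq (f := fun w : ℝ => w * Real.exp w) hex
  set W := lambertWNegOne (-x / Real.exp 1) with hW
  have h2 := key ((1 / 2) * (-1 - W))
  rw [show -1 - 2 * ((1 / 2) * (-1 - W)) = W by ring, he,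
    div_left_inj' (Real.exp_pos 1).ne', neg_inj] at h2
  exact wBase_strictAntiOn.injOn h0 (by rw [Set.mem_Ici]; linarith) (h1.trans h2)

end

/-!
The rate distortion function of a sequence of independent Gaussians `𝒩(0, v k)` is computed by
reverse water-filling, and both halves of that computation rest on one function, the tilted
information density `tiltedInfo v θ x y` at a water level `θ`.

*Converse.* Its sum over finitely many components has an exponential integral at most `1` against
the product of the marginals, because this holds for each fixed reproduction `y`. The Gibbs
variational inequality `ofReal_integral_le_klDiv` then bounds the mutual information below by the
integral of that sum, which depends only on the `v k` and the mean-square error. So every `θ > 0`,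
optimal or not, gives a lower bound (`le_rateDistortion`).

*Achievability.* Summed over the components with `θ < v k`, the same function is the logarithm of
a density with respect to the product of the source law and the reproduction law
`⨂ 𝒩(0, v k - θ)`. The joint law it defines has these marginals, mean-square error
`∑ min (θ, v k)` and mutual information `∑ ½ log (v k / θ)` (`rateDistortion_le`).

*Asymptotics.* With `δ = arcoth x` the variances are `σ² exp (-(2k+1)δ)`. Only the water levels
`σ² exp (-2nδ)` with `n` a natural number are used; for them all sums are exact: the rate is
`n² δ / 2`, and the distortion is `σ² exp (-2nδ) (n + 1 / (2 sinh δ))`, which is at most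
`(x / 2) σ² wBase (n δ)`. Given `D = (x / 2) σ² wBase w`, rounding `w / δ` up to an integer gives
an upper bound on the rate and rounding it down a lower bound. Divided by `x`, both agree with
`w² / 2` up to an error that tends to `0` uniformly for bounded `w`, since
`1 / x ≤ δ ≤ 1 / (x - 1)` and `x - 1 ≤ 1 / sinh δ ≤ x`
(`rateDistortion_coeffVar_asymptotics`). The assumption `D = Ω(x)` bounds `w` uniformly, through
`w * wBase w ≤ 1`. For `D ≥ (x / 2) σ²` the choice `n = 0` shows that the rate vanishes.
-/

noncomputable section

open scoped NNReal

/-! ### Relative entropy and exponential integrals -/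

/-- **Gibbs variational inequality**, in normalized form: a test function `f` with
`∫ exp f dρ ≤ 1` bounds the relative entropy of `π` from below by `∫ f dπ`. -/
theorem ofReal_integral_le_klDiv {A : Type*} [MeasurableSpace A] (π ρ : Measure A)
    [IsProbabilityMeasure π] [IsProbabilityMeasure ρ] {f : A → ℝ} (hf : Measurable f)
    (hint : Integrable f π) (hexp : ∫⁻ a, ENNReal.ofReal (Real.exp (f a)) ∂ρ ≤ 1) :
    ENNReal.ofReal (∫ a, f a ∂π) ≤ klDiv π ρ := by
  by_cases htop : klDiv π ρ = ⊤
  · rw [htop]; exact le_top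
  obtain ⟨hac, hllr⟩ := klDiv_ne_top_iff.1 htop
  rw [klDiv_of_ac_of_integrable hac hllr]
  apply ENNReal.ofReal_le_ofReal
  simp only [probReal_univ, add_sub_cancel_right]
  have hmeas : Measurable fun a => Real.exp (f a - llr π ρ a) :=
    (hf.sub (measurable_llr π ρ)).exp
  have hle : ∫⁻ a, ENNReal.ofReal (Real.exp (f a - llr π ρ a)) ∂π ≤ 1 := by
    calc ∫⁻ a, ENNReal.ofReal (Real.exp (f a - llr π ρ a)) ∂π
        = ∫⁻ a, ρ.rnDeriv π a * ENNReal.ofReal (Real.exp (f a)) ∂π := by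
          apply lintegral_congr_ae
          filter_upwards [exp_neg_llr hac, Measure.rnDeriv_lt_top ρ π] with a ha hlt
          rw [sub_eq_add_neg, Real.exp_add, ha, ENNReal.ofReal_mul (Real.exp_pos _).le,
            ENNReal.ofReal_toReal hlt.ne, mul_comm]
      _ = ∫⁻ a, ENNReal.ofReal (Real.exp (f a)) ∂(π.withDensity (ρ.rnDeriv π)) := by
          rw [lintegral_withDensity_eq_lintegral_mul _ (Measure.measurable_rnDeriv ρ π)
            hf.exp.ennreal_ofReal]
          rfl
      _ ≤ ∫⁻ a, ENNReal.ofReal (Real.exp (f a)) ∂ρ :=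
          lintegral_mono' (Measure.withDensity_rnDeriv_le ρ π) le_rfl
      _ ≤ 1 := hexp
  have hi : Integrable (fun a => Real.exp (f a - llr π ρ a)) π := by
    refine (lintegral_ofReal_ne_top_iff_integrable hmeas.aestronglyMeasurable
      (ae_of_all _ fun _ => (Real.exp_pos _).le)).1 (ne_top_of_le_ne_top ENNReal.one_ne_top hle)
  have h1 : ∫ a, Real.exp (f a - llr π ρ a) ∂π ≤ 1 := by
    rw [integral_eq_lintegral_of_nonneg_ae (ae_of_all _ fun _ => (Real.exp_pos _).le)
      hmeas.aestronglyMeasurable]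
    exact ENNReal.toReal_le_of_le_ofReal zero_le_one (by simpa using hle)
  have h2 : ∫ a, (f a - llr π ρ a) ∂π ≤ ∫ a, (Real.exp (f a - llr π ρ a) - 1) ∂π :=
    integral_mono (hint.sub hllr) (hi.sub (integrable_const 1)) fun a => by
      have := Real.add_one_le_exp (f a - llr π ρ a)
      simp only
      linarith
  rw [integral_sub hint hllr, integral_sub hi (integrable_const 1)] at h2
  simp only [integral_const, probReal_univ, smul_eq_mul, mul_one] at h2
  linarith

/-- The relative entropy of a probability measure given by the log-density `f` is `∫ f`. -/
theorem klDiv_withDensity_exp {A : Type*} [MeasurableSpace A] (ρ : Measure A)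
    [IsProbabilityMeasure ρ] {f : A → ℝ} (hf : Measurable f)
    [IsProbabilityMeasure (ρ.withDensity fun a => ENNReal.ofReal (Real.exp (f a)))]
    (hint : Integrable f (ρ.withDensity fun a => ENNReal.ofReal (Real.exp (f a)))) :
    klDiv (ρ.withDensity fun a => ENNReal.ofReal (Real.exp (f a))) ρ =
      ENNReal.ofReal (∫ a, f a ∂(ρ.withDensity fun a => ENNReal.ofReal (Real.exp (f a)))) := by
  set π := ρ.withDensity fun a => ENNReal.ofReal (Real.exp (f a)) with hπ
  have hac : π ≪ ρ := withDensity_absolutelyContinuous _ _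
  have hllr : llr π ρ =ᵐ[π] f := by
    filter_upwards [hac.ae_le (Measure.rnDeriv_withDensity ρ hf.exp.ennreal_ofReal)] with a ha
    rw [llr_def]
    simp only [hπ, ha]
    rw [ENNReal.toReal_ofReal (Real.exp_pos _).le, Real.log_exp]
  rw [klDiv_of_ac_of_integrable hac (hint.congr hllr.symm), integral_congr_ae hllr]
  simp

/-- A density on a product whose integral over each fibre of the second projection is `1` leaves
the second marginal unchanged. -/
theorem snd_prod_withDensity {A B : Type*} [MeasurableSpace A] [MeasurableSpace B]
    (μ : Measure A) (ν : Measure B) [SFinite μ] [SFinite ν] {G : A × B → ℝ≥0∞}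
    (hG : Measurable G) (h : ∀ b, ∫⁻ a, G (a, b) ∂μ = 1) :
    ((μ.prod ν).withDensity G).snd = ν := by
  ext s hs
  rw [Measure.snd_apply hs, withDensity_apply _ (measurable_snd hs),
    ← lintegral_indicator (measurable_snd hs),
    lintegral_prod_symm' _ (hG.indicator (measurable_snd hs)), ← lintegral_indicator_one hs]
  congr 1 with b
  by_cases hb : b ∈ s <;> simp [Set.indicator, hb, h]

theorem fst_prod_withDensity {A B : Type*} [MeasurableSpace A] [MeasurableSpace B]
    (μ : Measure A) (ν : Measure B) [SFinite μ] [SFinite ν] {G : A × B → ℝ≥0∞}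
    (hG : Measurable G) (h : ∀ a, ∫⁻ b, G (a, b) ∂ν = 1) :
    ((μ.prod ν).withDensity G).fst = μ := by
  ext s hs
  rw [Measure.fst_apply hs, withDensity_apply _ (measurable_fst hs),
    ← lintegral_indicator (measurable_fst hs),
    lintegral_prod _ (hG.indicator (measurable_fst hs)).aemeasurable, ← lintegral_indicator_one hs]
  congr 1 with a
  by_cases ha : a ∈ s <;> simp [Set.indicator, ha, h]

theorem lintegral_finsetProd_infinitePi {ι : Type*} (γ : ι → Measure ℝ)
    [∀ i, IsProbabilityMeasure (γ i)] (s : Finset ι) {h : ι → ℝ → ℝ≥0∞}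
    (hh : ∀ i, Measurable (h i)) :
    ∫⁻ x, ∏ i ∈ s, h i (x i) ∂(Measure.infinitePi γ) = ∏ i ∈ s, ∫⁻ t, h i t ∂(γ i) := by
  rw [lintegral_prod_eq_prod_lintegral_of_indepFun s (fun i (x : ι → ℝ) => h i (x i))
    (iIndepFun_infinitePi hh) fun i => (hh i).comp (measurable_pi_apply i)]
  refine Finset.prod_congr rfl fun i _ => ?_
  rw [← (measurePreserving_eval_infinitePi γ i).lintegral_comp (hh i)]

/-! ### The scalar Gaussian test channel -/

/-- The tilted information density of a scalar source `𝒩(0, v)` at water level `θ`. For `θ ≤ v`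
it is the log-likelihood ratio of `𝒩(y, θ)` to `𝒩(0, v)` at the point `x`; for `v < θ` the
source is not described at all, and the formula reduces to `(x² - (x - y)²) / (2 θ)`. -/
def tiltedInfo (v θ x y : ℝ) : ℝ :=
  1 / 2 * Real.log (max v θ / θ) + x ^ 2 / (2 * max v θ) - (x - y) ^ 2 / (2 * θ)

theorem measurable_exp_tiltedInfo_fst (v θ y : ℝ) :
    Measurable fun x => ENNReal.ofReal (Real.exp (tiltedInfo v θ x y)) := by
  unfold tiltedInfo; fun_prop

theorem measurable_exp_tiltedInfo_snd (v θ x : ℝ) :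
    Measurable fun y => ENNReal.ofReal (Real.exp (tiltedInfo v θ x y)) := by
  unfold tiltedInfo; fun_prop

theorem exp_half_log {t : ℝ} (ht : 0 < t) : Real.exp (1 / 2 * Real.log t) = Real.sqrt t := by
  rw [Real.sqrt_eq_rpow, Real.rpow_def_of_pos ht, mul_comm]

theorem exp_tiltedInfo_mul_gaussianPDFReal {v θ : ℝ≥0} (hθ : 0 < θ) (h : θ ≤ v) (x y : ℝ) :
    Real.exp (tiltedInfo v θ x y) * gaussianPDFReal 0 v x = gaussianPDFReal y θ x := by
  have hθ' : (0 : ℝ) < θ := hθ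
  have hv' : (0 : ℝ) < v := hθ'.trans_le h
  rw [tiltedInfo, max_eq_left (by exact_mod_cast h), add_sub_assoc, Real.exp_add,
    exp_half_log (by positivity), gaussianPDFReal, gaussianPDFReal]
  have hs : Real.sqrt (v / θ) * (Real.sqrt (2 * Real.pi * v))⁻¹ =
      (Real.sqrt (2 * Real.pi * θ))⁻¹ := by
    rw [← Real.sqrt_inv, ← Real.sqrt_inv, ← Real.sqrt_mul (by positivity)]
    congr 1
    field_simp
  rw [← hs]
  have he : Real.exp (-(x - y) ^ 2 / (2 * θ)) = Real.exp (x ^ 2 / (2 * v) - (x - y) ^ 2 / (2 * θ)) *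
      Real.exp (-(x - 0) ^ 2 / (2 * v)) := by
    rw [← Real.exp_add]
    congr 1
    ring
  rw [he]
  ring

/-- The test channel is the *backward* channel: given the reproduction `y`, the source is
`𝒩(y, θ)`. -/
theorem gaussianReal_withDensity_exp_tiltedInfo {v θ : ℝ≥0} (hθ : 0 < θ) (h : θ ≤ v) (y : ℝ) :
    (gaussianReal 0 v).withDensity (fun x => ENNReal.ofReal (Real.exp (tiltedInfo v θ x y))) =
      gaussianReal y θ := by
  rw [gaussianReal_of_var_ne_zero _ (hθ.trans_le h).ne', gaussianReal_of_var_ne_zero _ hθ.ne',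
    ← withDensity_mul _ (measurable_gaussianPDF 0 v)
      (measurable_exp_tiltedInfo_fst v θ y)]
  congr 1 with x
  rw [Pi.mul_apply, gaussianPDF, gaussianPDF, ← exp_tiltedInfo_mul_gaussianPDFReal hθ h x y,
    ENNReal.ofReal_mul (Real.exp_pos _).le, mul_comm]

theorem lintegral_exp_tiltedInfo_fst {v θ : ℝ≥0} (hθ : 0 < θ) (h : θ ≤ v) (y : ℝ) :
    ∫⁻ x, ENNReal.ofReal (Real.exp (tiltedInfo v θ x y)) ∂(gaussianReal 0 v) = 1 := by
  rw [← setLIntegral_univ, ← withDensity_apply _ MeasurableSet.univ,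
    gaussianReal_withDensity_exp_tiltedInfo hθ h y, measure_univ]

/-- Below the water level, `v < θ`, the integral is the Gaussian moment generating function and
equals `exp (-(θ - v) y² / (2 θ²))`. -/
theorem lintegral_exp_tiltedInfo_fst_le {v θ : ℝ≥0} (hθ : 0 < θ) (y : ℝ) :
    ∫⁻ x, ENNReal.ofReal (Real.exp (tiltedInfo v θ x y)) ∂(gaussianReal 0 v) ≤ 1 := by
  rcases le_total θ v with h | h
  · exact (lintegral_exp_tiltedInfo_fst hθ h y).le
  have hθ' : (0 : ℝ) < θ := hθ
  have hv : (v : ℝ) ≤ θ := h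
  have hrw : ∀ x : ℝ, Real.exp (tiltedInfo v θ x y) =
      Real.exp (y / θ * x) * Real.exp (-y ^ 2 / (2 * θ)) := by
    intro x
    rw [tiltedInfo, max_eq_right hv, div_self hθ'.ne', Real.log_one, ← Real.exp_add]
    congr 1
    field_simp
    ring
  have hi : Integrable (fun x : ℝ => Real.exp (y / θ * x) * Real.exp (-y ^ 2 / (2 * θ)))
      (gaussianReal 0 v) := (integrable_exp_mul_gaussianReal _).mul_const _
  simp_rw [hrw]
  rw [← ofReal_integral_eq_lintegral_ofReal hi (ae_of_all _ fun _ => by positivity),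
    integral_mul_const]
  have hm := congrFun (mgf_id_gaussianReal (μ := 0) (v := v)) (y / θ)
  simp only [mgf, id] at hm
  rw [hm, ← Real.exp_add, ← ENNReal.ofReal_one]
  apply ENNReal.ofReal_le_ofReal
  rw [Real.exp_le_one_iff]
  have h2 : 0 * (y / θ) + v * (y / θ) ^ 2 / 2 + -y ^ 2 / (2 * θ) =
      -((θ - v) * (y / θ) ^ 2 / 2) := by
    field_simp
    ring
  rw [h2, neg_nonpos]
  have : (0 : ℝ) ≤ θ - v := by linarith
  positivity

/-- With reproduction law `𝒩(0, v - θ)`, the test channel has source law `𝒩(0, v)`: for each `x`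
the integrand is the density of the conditional law of the reproduction given the source. -/
theorem lintegral_exp_tiltedInfo_snd {v θ : ℝ≥0} (hθ : 0 < θ) (h : θ < v) (x : ℝ) :
    ∫⁻ y, ENNReal.ofReal (Real.exp (tiltedInfo v θ x y)) ∂(gaussianReal 0 (v - θ)) = 1 := by
  have hθ' : (0 : ℝ) < θ := hθ
  have hlt : (θ : ℝ) < v := h
  have hv' : (0 : ℝ) < v := hθ'.trans hlt
  have hsub : ((v - θ : ℝ≥0) : ℝ) = v - θ := NNReal.coe_sub h.le
  have hd : (0 : ℝ) < v - θ := by linarith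
  have hne : v - θ ≠ 0 := (tsub_pos_of_lt h).ne'
  have hne2 : (v - θ) * θ / v ≠ 0 := div_ne_zero (mul_ne_zero hne hθ.ne') (hθ.trans h).ne'
  rw [gaussianReal_of_var_ne_zero _ hne, lintegral_withDensity_eq_lintegral_mul _
    (measurable_gaussianPDF _ _)
    (measurable_exp_tiltedInfo_snd v θ x),
    ← lintegral_gaussianPDF_eq_one (x * (v - θ) / v) hne2]
  congr 1 with y
  rw [Pi.mul_apply, gaussianPDF, gaussianPDF, ← ENNReal.ofReal_mul (gaussianPDFReal_nonneg _ _ _)]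
  congr 1
  rw [tiltedInfo, max_eq_left hlt.le, add_sub_assoc, Real.exp_add,
    exp_half_log (by positivity), gaussianPDFReal, gaussianPDFReal]
  push_cast
  rw [hsub]
  have hs : (Real.sqrt (2 * Real.pi * ((v - θ) * θ / v)))⁻¹ =
      Real.sqrt (v / θ) * (Real.sqrt (2 * Real.pi * (v - θ)))⁻¹ := by
    rw [← Real.sqrt_inv, ← Real.sqrt_inv, ← Real.sqrt_mul (by positivity)]
    congr 1
    field_simp
  have he : Real.exp (-(y - x * (v - θ) / v) ^ 2 / (2 * ((v - θ) * θ / v))) =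
      Real.exp (-(y - 0) ^ 2 / (2 * (v - θ))) *
        Real.exp (x ^ 2 / (2 * v) - (x - y) ^ 2 / (2 * θ)) := by
    rw [← Real.exp_add]
    congr 1
    field_simp
    ring
  rw [hs, he]
  ring

theorem lintegral_sq_sub_gaussianReal (m : ℝ) (v : ℝ≥0) :
    ∫⁻ x, ENNReal.ofReal ((x - m) ^ 2) ∂(gaussianReal m v) = v := by
  have hL : MemLp (fun x : ℝ => x) 2 (gaussianReal m v) := memLp_id_gaussianReal 2
  have hi : Integrable (fun x : ℝ => (x - m) ^ 2) (gaussianReal m v) :=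
    (hL.sub (memLp_const m)).integrable_sq
  rw [← ofReal_integral_eq_lintegral_ofReal hi (ae_of_all _ fun _ => sq_nonneg _)]
  have h := variance_eq_integral (μ := gaussianReal m v) (X := fun x => x) measurable_id.aemeasurable
  rw [variance_fun_id_gaussianReal, integral_id_gaussianReal] at h
  rw [← h, ENNReal.ofReal_coe_nnreal]

/-! ### Rate distortion bounds for a Gaussian sequence -/

/-- The total tilted information density of the first `n` components of a sequence with
independent `𝒩(0, v k)` components, at a common water level `θ`. -/
def seqTiltedInfo (v : ℕ → ℝ≥0) (θ : ℝ≥0) (n : ℕ) (p : (ℕ → ℝ) × (ℕ → ℝ)) : ℝ :=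
  ∑ k ∈ Finset.range n, tiltedInfo (v k) θ (p.1 k) (p.2 k)

theorem measurable_seqTiltedInfo (v : ℕ → ℝ≥0) (θ : ℝ≥0) (n : ℕ) :
    Measurable (seqTiltedInfo v θ n) := by
  unfold seqTiltedInfo tiltedInfo; fun_prop

theorem ofReal_exp_seqTiltedInfo (v : ℕ → ℝ≥0) (θ : ℝ≥0) (n : ℕ) (p : (ℕ → ℝ) × (ℕ → ℝ)) :
    ENNReal.ofReal (Real.exp (seqTiltedInfo v θ n p)) =
      ∏ k ∈ Finset.range n, ENNReal.ofReal (Real.exp (tiltedInfo (v k) θ (p.1 k) (p.2 k))) := by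
  rw [seqTiltedInfo, Real.exp_sum, ENNReal.ofReal_prod_of_nonneg fun _ _ => (Real.exp_pos _).le]

theorem measurePreserving_fst_apply {v : ℕ → ℝ≥0} {π : Measure ((ℕ → ℝ) × (ℕ → ℝ))}
    (hfst : π.fst = Measure.infinitePi fun k => gaussianReal 0 (v k)) (k : ℕ) :
    MeasurePreserving (fun p : (ℕ → ℝ) × (ℕ → ℝ) => p.1 k) π (gaussianReal 0 (v k)) := by
  have h1 : MeasurePreserving (Prod.fst : (ℕ → ℝ) × (ℕ → ℝ) → _) π
      (Measure.infinitePi fun k => gaussianReal 0 (v k)) := ⟨measurable_fst, hfst⟩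
  exact (measurePreserving_eval_infinitePi _ k).comp h1

theorem lintegral_fst_apply_sq {v : ℕ → ℝ≥0} {π : Measure ((ℕ → ℝ) × (ℕ → ℝ))}
    (hfst : π.fst = Measure.infinitePi fun k => gaussianReal 0 (v k)) (k : ℕ) :
    ∫⁻ p, ENNReal.ofReal (p.1 k ^ 2) ∂π = v k := by
  have h := (measurePreserving_fst_apply hfst k).lintegral_comp
    (f := fun x => ENNReal.ofReal ((x - 0) ^ 2)) (by fun_prop)
  rw [lintegral_sq_sub_gaussianReal] at h
  simpa using h

theorem integrable_and_integral_of_lintegral {A : Type*} [MeasurableSpace A] {π : Measure A}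
    {f : A → ℝ} (hf : Measurable f) (h0 : ∀ a, 0 ≤ f a) {c : ℝ≥0}
    (h : ∫⁻ a, ENNReal.ofReal (f a) ∂π = c) : Integrable f π ∧ ∫ a, f a ∂π = c := by
  refine ⟨(lintegral_ofReal_ne_top_iff_integrable hf.aestronglyMeasurable (ae_of_all _ h0)).1
    (by rw [h]; exact ENNReal.coe_ne_top), ?_⟩
  rw [integral_eq_lintegral_of_nonneg_ae (ae_of_all _ h0) hf.aestronglyMeasurable, h,
    ENNReal.coe_toReal]

/-- The expected tilted information depends on the joint law only through the source law and the
componentwise mean-square errors. -/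
theorem integral_seqTiltedInfo {v : ℕ → ℝ≥0} {θ : ℝ≥0} {n : ℕ}
    {π : Measure ((ℕ → ℝ) × (ℕ → ℝ))} [IsProbabilityMeasure π]
    (hfst : π.fst = Measure.infinitePi fun k => gaussianReal 0 (v k))
    (hint : ∀ k < n, Integrable (fun p : (ℕ → ℝ) × (ℕ → ℝ) => (p.1 k - p.2 k) ^ 2) π) :
    Integrable (seqTiltedInfo v θ n) π ∧
    ∫ p, seqTiltedInfo v θ n p ∂π = ∑ k ∈ Finset.range n,
      (1 / 2 * Real.log (max (v k : ℝ) θ / θ) + v k / (2 * max (v k : ℝ) θ)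
        - (∫ p, (p.1 k - p.2 k) ^ 2 ∂π) / (2 * θ)) := by
  have hsq : ∀ k, Integrable (fun p : (ℕ → ℝ) × (ℕ → ℝ) => p.1 k ^ 2) π ∧
      ∫ p, p.1 k ^ 2 ∂π = v k := fun k =>
    integrable_and_integral_of_lintegral (f := fun p : (ℕ → ℝ) × (ℕ → ℝ) => p.1 k ^ 2)
      (by fun_prop) (fun _ => sq_nonneg _) (lintegral_fst_apply_sq hfst k)
  have hi : ∀ k < n, Integrable (fun p : (ℕ → ℝ) × (ℕ → ℝ) =>
      1 / 2 * Real.log (max (v k : ℝ) θ / θ) + p.1 k ^ 2 / (2 * max (v k : ℝ) θ)) π := fun k _ =>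
    (integrable_const _).add ((hsq k).1.div_const _)
  have hterm : ∀ k ∈ Finset.range n, Integrable (fun p : (ℕ → ℝ) × (ℕ → ℝ) =>
      1 / 2 * Real.log (max (v k : ℝ) θ / θ) + p.1 k ^ 2 / (2 * max (v k : ℝ) θ)
        - (p.1 k - p.2 k) ^ 2 / (2 * θ)) π := fun k hk =>
    (hi k (Finset.mem_range.1 hk)).sub ((hint k (Finset.mem_range.1 hk)).div_const _)
  constructor
  · exact integrable_finsetSum _ hterm
  · simp only [seqTiltedInfo, tiltedInfo]
    rw [integral_finsetSum _ hterm]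
    refine Finset.sum_congr rfl fun k hk => ?_
    have hk := Finset.mem_range.1 hk
    rw [integral_sub (hi k hk) ((hint k hk).div_const _),
      integral_add (integrable_const _) ((hsq k).1.div_const _), integral_div, integral_div,
      (hsq k).2]
    simp

theorem lintegral_sq_sub_le_meanSquareError (π : Measure ((ℕ → ℝ) × (ℕ → ℝ))) (n : ℕ) :
    ∑ k ∈ Finset.range n, ∫⁻ p, ENNReal.ofReal ((p.1 k - p.2 k) ^ 2) ∂π ≤ meanSquareError π := by
  rw [← lintegral_finsetSum _ fun k _ => by fun_prop]
  exact lintegral_mono fun p => ENNReal.sum_le_tsum _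

/-- Converse bound for a Gaussian sequence: every water level `θ` gives a lower bound on the
rate distortion function, by testing the mutual information against `seqTiltedInfo`. -/
theorem le_rateDistortion {v : ℕ → ℝ≥0} {θ : ℝ≥0} (hθ : 0 < θ) {D : ℝ} (hD : 0 ≤ D) (N : ℕ) :
    ENNReal.ofReal (∑ k ∈ Finset.range N,
      (1 / 2 * Real.log (max (v k : ℝ) θ / θ) + v k / (2 * max (v k : ℝ) θ)) - D / (2 * θ)) ≤
    rateDistortion (Measure.infinitePi fun k => gaussianReal 0 (v k)) D := by
  refine le_iInf fun π => le_iInf fun hfst => le_iInf fun hmse => ?_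
  have hπ : IsProbabilityMeasure π := ⟨by rw [← Measure.fst_univ, hfst, measure_univ]⟩
  have hle := (lintegral_sq_sub_le_meanSquareError π N).trans hmse
  have hint : ∀ k < N, Integrable (fun p : (ℕ → ℝ) × (ℕ → ℝ) => (p.1 k - p.2 k) ^ 2) π := by
    intro k hk
    refine (lintegral_ofReal_ne_top_iff_integrable (Measurable.aestronglyMeasurable (by fun_prop))
      (ae_of_all _ fun _ => sq_nonneg _)).1 (ne_top_of_le_ne_top ENNReal.ofReal_ne_top
        (le_trans ?_ hle))
    exact Finset.single_le_sum (f := fun k => ∫⁻ p : (ℕ → ℝ) × (ℕ → ℝ),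
      ENNReal.ofReal ((p.1 k - p.2 k) ^ 2) ∂π) (fun _ _ => zero_le) (Finset.mem_range.2 hk)
  have hsum : ∑ k ∈ Finset.range N, ∫ p, (p.1 k - p.2 k) ^ 2 ∂π ≤ D := by
    rw [← ENNReal.ofReal_le_ofReal_iff hD,
      ENNReal.ofReal_sum_of_nonneg fun _ _ => integral_nonneg fun _ => sq_nonneg _]
    refine le_trans (le_of_eq (Finset.sum_congr rfl fun k hk => ?_)) hle
    exact ofReal_integral_eq_lintegral_ofReal (hint k (Finset.mem_range.1 hk))
      (ae_of_all _ fun _ => sq_nonneg _)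
  obtain ⟨h1, h2⟩ := integral_seqTiltedInfo (θ := θ) hfst hint
  have hexp : ∫⁻ p, ENNReal.ofReal (Real.exp (seqTiltedInfo v θ N p)) ∂(π.fst.prod π.snd) ≤ 1 := by
    rw [lintegral_prod_symm' _ (measurable_seqTiltedInfo v θ N).exp.ennreal_ofReal]
    calc _ ≤ ∫⁻ _, 1 ∂π.snd := by
          refine lintegral_mono fun y => ?_
          simp_rw [ofReal_exp_seqTiltedInfo]
          rw [hfst, lintegral_finsetProd_infinitePi (fun k => gaussianReal 0 (v k)) _
            (h := fun k t => ENNReal.ofReal (Real.exp (tiltedInfo (v k) θ t (y k))))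
            fun k => measurable_exp_tiltedInfo_fst _ _ _]
          exact Finset.prod_le_one' fun k _ => lintegral_exp_tiltedInfo_fst_le hθ (y k)
      _ = 1 := by simp
  refine le_trans (ENNReal.ofReal_le_ofReal ?_)
    (ofReal_integral_le_klDiv π (π.fst.prod π.snd) (measurable_seqTiltedInfo v θ N) h1 hexp)
  rw [h2, Finset.sum_sub_distrib, ← Finset.sum_div]
  gcongr

/-- The law of the reproduction sequence in reverse water-filling: independent `𝒩(0, v k - θ)`
components for `k < n`, and zeros from index `n` on. -/
def reproductionLaw (v : ℕ → ℝ≥0) (θ : ℝ≥0) (n : ℕ) : Measure (ℕ → ℝ) :=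
  Measure.infinitePi fun k => gaussianReal 0 (if k < n then v k - θ else 0)

/-- The reverse water-filling test channel: the joint law of source and reproduction, given by its
density with respect to the product of its marginals. -/
def waterFillingLaw (v : ℕ → ℝ≥0) (θ : ℝ≥0) (n : ℕ) : Measure ((ℕ → ℝ) × (ℕ → ℝ)) :=
  ((Measure.infinitePi fun k => gaussianReal 0 (v k)).prod (reproductionLaw v θ n)).withDensity
    fun p => ENNReal.ofReal (Real.exp (seqTiltedInfo v θ n p))

instance (v : ℕ → ℝ≥0) (θ : ℝ≥0) (n : ℕ) : IsProbabilityMeasure (reproductionLaw v θ n) := by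
  unfold reproductionLaw; infer_instance

section WaterFilling

variable {v : ℕ → ℝ≥0} {θ : ℝ≥0} {n : ℕ}

theorem fst_waterFillingLaw (hθ : 0 < θ) (hv : ∀ k < n, θ < v k) :
    (waterFillingLaw v θ n).fst = Measure.infinitePi fun k => gaussianReal 0 (v k) := by
  refine fst_prod_withDensity _ _ (measurable_seqTiltedInfo v θ n).exp.ennreal_ofReal fun x => ?_
  simp_rw [ofReal_exp_seqTiltedInfo]
  rw [reproductionLaw, lintegral_finsetProd_infinitePi _ _
    (h := fun k t => ENNReal.ofReal (Real.exp (tiltedInfo (v k) θ (x k) t)))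
    fun k => measurable_exp_tiltedInfo_snd _ _ _]
  refine Finset.prod_eq_one fun k hk => ?_
  have hk := Finset.mem_range.1 hk
  rw [if_pos hk]
  exact lintegral_exp_tiltedInfo_snd hθ (hv k hk) (x k)

theorem snd_waterFillingLaw (hθ : 0 < θ) (hv : ∀ k < n, θ < v k) :
    (waterFillingLaw v θ n).snd = reproductionLaw v θ n := by
  refine snd_prod_withDensity _ _ (measurable_seqTiltedInfo v θ n).exp.ennreal_ofReal fun y => ?_
  simp_rw [ofReal_exp_seqTiltedInfo]
  rw [lintegral_finsetProd_infinitePi _ _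
    (h := fun k t => ENNReal.ofReal (Real.exp (tiltedInfo (v k) θ t (y k))))
    fun k => measurable_exp_tiltedInfo_fst _ _ _]
  exact Finset.prod_eq_one fun k hk =>
    lintegral_exp_tiltedInfo_fst hθ (hv k (Finset.mem_range.1 hk)).le (y k)

theorem lintegral_sq_sub_waterFillingLaw_of_lt (hθ : 0 < θ) (hv : ∀ k < n, θ < v k) {k : ℕ}
    (hk : k < n) : ∫⁻ p, ENNReal.ofReal ((p.1 k - p.2 k) ^ 2) ∂(waterFillingLaw v θ n) = θ := by
  rw [waterFillingLaw, lintegral_withDensity_eq_lintegral_mul _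
    (measurable_seqTiltedInfo v θ n).exp.ennreal_ofReal (by fun_prop),
    lintegral_prod_symm' _ ((measurable_seqTiltedInfo v θ n).exp.ennreal_ofReal.mul (by fun_prop))]
  suffices h : ∀ y : ℕ → ℝ, ∫⁻ x : ℕ → ℝ,
      ENNReal.ofReal (Real.exp (seqTiltedInfo v θ n (x, y))) *
        ENNReal.ofReal ((x k - y k) ^ 2) ∂(Measure.infinitePi fun k => gaussianReal 0 (v k)) = θ by
    simp only [Pi.mul_apply]
    simp_rw [h]
    simp
  intro y
  -- The squared error is absorbed into the `k`th factor of the product density.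
  let h : ℕ → ℝ → ℝ≥0∞ := fun j t => ENNReal.ofReal (Real.exp (tiltedInfo (v j) θ t (y j))) *
    if j = k then ENNReal.ofReal ((t - y k) ^ 2) else 1
  have hh : ∀ j, Measurable (h j) := fun j => by
    refine (measurable_exp_tiltedInfo_fst _ _ _).mul ?_
    split_ifs <;> fun_prop
  have hprod : ∀ x : ℕ → ℝ, ENNReal.ofReal (Real.exp (seqTiltedInfo v θ n (x, y))) *
      ENNReal.ofReal ((x k - y k) ^ 2) = ∏ j ∈ Finset.range n, h j (x j) := by
    intro x
    simp only [h]
    rw [Finset.prod_mul_distrib, ofReal_exp_seqTiltedInfo, Finset.prod_ite_eq',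
      if_pos (Finset.mem_range.2 hk)]
  simp_rw [hprod]
  rw [lintegral_finsetProd_infinitePi _ _ hh, Finset.prod_eq_single k]
  · simp only [h, if_true]
    rw [← lintegral_sq_sub_gaussianReal (y k) θ,
      ← gaussianReal_withDensity_exp_tiltedInfo hθ (hv k hk).le (y k),
      lintegral_withDensity_eq_lintegral_mul _ (measurable_exp_tiltedInfo_fst _ _ _) (by fun_prop)]
    rfl
  · intro j hj hjk
    simp only [h, if_neg hjk, mul_one]
    exact lintegral_exp_tiltedInfo_fst hθ (hv j (Finset.mem_range.1 hj)).le (y j)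
  · exact fun hkn => absurd (Finset.mem_range.2 hk) hkn

theorem lintegral_sq_sub_waterFillingLaw_of_le (hθ : 0 < θ) (hv : ∀ k < n, θ < v k) {k : ℕ}
    (hk : n ≤ k) : ∫⁻ p, ENNReal.ofReal ((p.1 k - p.2 k) ^ 2) ∂(waterFillingLaw v θ n) = v k := by
  rw [← lintegral_fst_apply_sq (fst_waterFillingLaw hθ hv) k]
  have h1 : MeasurePreserving (Prod.snd : (ℕ → ℝ) × (ℕ → ℝ) → _) (waterFillingLaw v θ n)
      (reproductionLaw v θ n) := ⟨measurable_snd, snd_waterFillingLaw hθ hv⟩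
  have h2 := (measurePreserving_eval_infinitePi
    (fun k => gaussianReal 0 (if k < n then v k - θ else 0)) k).comp h1
  rw [if_neg hk.not_gt, gaussianReal_zero_var] at h2
  have h3 : ∀ᵐ p ∂(waterFillingLaw v θ n), p.2 k = 0 := by
    refine h2.quasiMeasurePreserving.ae (p := fun t => t = 0) ?_
    simp [ae_dirac_eq]
  refine lintegral_congr_ae ?_
  filter_upwards [h3] with p hp
  rw [hp, sub_zero]

theorem meanSquareError_waterFillingLaw (hθ : 0 < θ) (hv : ∀ k < n, θ < v k) :
    meanSquareError (waterFillingLaw v θ n) =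
      ∑' k, ((if k < n then θ else v k : ℝ≥0) : ℝ≥0∞) := by
  rw [meanSquareError, lintegral_tsum fun k => by fun_prop]
  congr 1 with k
  split_ifs with hk
  · exact lintegral_sq_sub_waterFillingLaw_of_lt hθ hv hk
  · exact lintegral_sq_sub_waterFillingLaw_of_le hθ hv (not_lt.1 hk)

theorem mutualInfo_waterFillingLaw (hθ : 0 < θ) (hv : ∀ k < n, θ < v k) :
    mutualInfo (waterFillingLaw v θ n) =
      ENNReal.ofReal (∑ k ∈ Finset.range n, 1 / 2 * Real.log (v k / θ)) := by
  have hπ : IsProbabilityMeasure (waterFillingLaw v θ n) :=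
    ⟨by rw [← Measure.fst_univ, fst_waterFillingLaw hθ hv, measure_univ]⟩
  have hsq : ∀ k < n, Integrable (fun p : (ℕ → ℝ) × (ℕ → ℝ) => (p.1 k - p.2 k) ^ 2)
      (waterFillingLaw v θ n) ∧ ∫ p, (p.1 k - p.2 k) ^ 2 ∂(waterFillingLaw v θ n) = θ :=
    fun k hk => integrable_and_integral_of_lintegral
      (f := fun p : (ℕ → ℝ) × (ℕ → ℝ) => (p.1 k - p.2 k) ^ 2) (by fun_prop)
      (fun _ => sq_nonneg _) (lintegral_sq_sub_waterFillingLaw_of_lt hθ hv hk)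
  obtain ⟨h1, h2⟩ := integral_seqTiltedInfo (θ := θ) (fst_waterFillingLaw hθ hv)
    fun k hk => (hsq k hk).1
  rw [mutualInfo, fst_waterFillingLaw hθ hv, snd_waterFillingLaw hθ hv]
  rw [waterFillingLaw] at hπ h1 h2 ⊢
  rw [klDiv_withDensity_exp _ (measurable_seqTiltedInfo v θ n) h1, h2]
  congr 1
  refine Finset.sum_congr rfl fun k hk => ?_
  have hk := Finset.mem_range.1 hk
  have hlt : (θ : ℝ) < v k := hv k hk
  have hθ' : (0 : ℝ) < θ := hθ
  have h3 := (hsq k hk).2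
  rw [waterFillingLaw] at h3
  rw [h3, max_eq_left hlt.le]
  have : (v k : ℝ) ≠ 0 := (hθ'.trans hlt).ne'
  field_simp
  ring

/-- Achievability for a Gaussian sequence, by reverse water-filling at level `θ`. -/
theorem rateDistortion_le (hθ : 0 < θ) (hv : ∀ k < n, θ < v k) {D : ℝ}
    (hD : ∑' k, ((if k < n then θ else v k : ℝ≥0) : ℝ≥0∞) ≤ ENNReal.ofReal D) :
    rateDistortion (Measure.infinitePi fun k => gaussianReal 0 (v k)) D ≤
      ENNReal.ofReal (∑ k ∈ Finset.range n, 1 / 2 * Real.log (v k / θ)) := by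
  rw [← mutualInfo_waterFillingLaw hθ hv]
  exact iInf_le_of_le _ (iInf_le_of_le (fst_waterFillingLaw hθ hv)
    (iInf_le_of_le ((meanSquareError_waterFillingLaw hθ hv).trans_le hD) le_rfl))

end WaterFilling

/-! ### Bounds for `arcoth` and `wBase` -/

theorem one_div_le_arcoth {x : ℝ} (hx : 1 < x) : 1 / x ≤ arcoth x := by
  have hx0 : 0 < x := by linarith
  have h1 : 1 / x < 1 := (div_lt_one hx0).2 hx
  have h2 : 0 < 1 / x := by positivity
  -- The leading term of the power series of `log ((1 + u) / (1 - u))` at `u = 1 / x`.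
  have h := le_hasSum (Real.hasSum_log_sub_log_of_abs_lt_one (x := 1 / x)
    (by rwa [abs_of_pos h2])) 0 fun k _ => by positivity
  rw [← Real.log_div (by positivity) (by linarith)] at h
  have h3 : (1 + 1 / x) / (1 - 1 / x) = (x + 1) / (x - 1) := by
    have : x - 1 ≠ 0 := by linarith
    field_simp
  rw [h3] at h
  rw [arcoth]
  norm_num at h ⊢
  linarith

theorem sub_one_le_inv_sinh_arcoth {x : ℝ} (hx : 1 < x) : x - 1 ≤ 1 / Real.sinh (arcoth x) := by
  obtain ⟨h0, h⟩ := arcoth_spec hx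
  have hs : 0 < Real.sinh (arcoth x) := Real.sinh_pos_iff.2 h0
  rw [div_eq_iff hs.ne'] at h
  rw [le_div_iff₀ hs]
  have := Real.cosh_sub_sinh (arcoth x)
  have : Real.exp (-arcoth x) ≤ 1 := Real.exp_le_one_iff.2 (by linarith)
  linarith

theorem inv_sinh_arcoth_le {x : ℝ} (hx : 1 < x) : 1 / Real.sinh (arcoth x) ≤ x := by
  obtain ⟨h0, h⟩ := arcoth_spec hx
  have hs : 0 < Real.sinh (arcoth x) := Real.sinh_pos_iff.2 h0
  conv_rhs => rw [← h]
  gcongr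
  exact Real.one_le_cosh _

theorem arcoth_le_one_div {x : ℝ} (hx : 1 < x) : arcoth x ≤ 1 / (x - 1) := by
  have h0 := (arcoth_spec hx).1
  have hs : 0 < Real.sinh (arcoth x) := Real.sinh_pos_iff.2 h0
  refine (Real.self_le_sinh_iff.2 h0.le).trans ?_
  rw [le_div_comm₀ hs (by linarith)]
  exact sub_one_le_inv_sinh_arcoth hx

theorem hasSum_exp_odd_mul {δ : ℝ} (hδ : 0 < δ) :
    HasSum (fun j : ℕ => Real.exp (-((2 * j + 1) * δ))) (1 / (2 * Real.sinh δ)) := by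
  have hlt : Real.exp (-(2 * δ)) < 1 := by rw [Real.exp_lt_one_iff]; linarith
  have h := (hasSum_geometric_of_lt_one (Real.exp_pos (-(2 * δ))).le hlt).mul_left
    (Real.exp (-δ))
  convert! h using 1
  · ext j
    rw [← Real.exp_nat_mul, ← Real.exp_add]
    congr 1
    ring
  · have hs : 0 < Real.sinh δ := Real.sinh_pos_iff.2 hδ
    have h1 : 1 - Real.exp (-(2 * δ)) ≠ 0 := by linarith
    rw [← div_eq_mul_inv, div_eq_div_iff (by positivity) h1, Real.sinh_eq]
    have h2 : Real.exp (-(2 * δ)) = Real.exp (-δ) * Real.exp (-δ) := by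
      rw [← Real.exp_add]; congr 1; ring
    have h3 : Real.exp (-δ) * Real.exp δ = 1 := by rw [← Real.exp_add]; simp
    rw [h2]
    linear_combination -h3

theorem mul_wBase_le_one {w : ℝ} (hw : 0 ≤ w) : w * wBase w ≤ 1 := by
  have h := Real.quadratic_le_exp_of_nonneg (x := 2 * w) (by linarith)
  rw [wBase, Real.exp_neg, ← mul_assoc, ← div_eq_mul_inv, div_le_one (Real.exp_pos _)]
  nlinarith

/-! ### Reverse water-filling for the Hermite coefficients -/

/-- The variance `σ² ρ^(2k+1)` of the `k`th Hermite coefficient, where `x = α β`. -/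
def coeffVar (σ x : ℝ) (k : ℕ) : ℝ≥0 := Real.toNNReal (σ ^ 2 * rho x ^ (2 * k + 1))

/-- The water level `σ² exp (-2nδ)`, `δ = arcoth x`, which lies between the variances of index
`n - 1` and `n`: exactly the first `n` coefficients rise above it. -/
def waterLevel (σ x : ℝ) (n : ℕ) : ℝ≥0 := Real.toNNReal (σ ^ 2 * Real.exp (-(2 * (n * arcoth x))))

theorem coe_coeffVar (σ x : ℝ) (k : ℕ) :
    (coeffVar σ x k : ℝ) = σ ^ 2 * Real.exp (-((2 * k + 1) * arcoth x)) := by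
  rw [coeffVar, rho, Real.coe_toNNReal _ (by positivity), ← Real.exp_nat_mul]
  congr 2
  push_cast
  ring

theorem coe_waterLevel (σ x : ℝ) (n : ℕ) :
    (waterLevel σ x n : ℝ) = σ ^ 2 * Real.exp (-(2 * (n * arcoth x))) :=
  Real.coe_toNNReal _ (by positivity)

section Bounds

variable {σ x : ℝ}

theorem waterLevel_pos (hσ : 0 < σ) (n : ℕ) : 0 < waterLevel σ x n :=
  Real.toNNReal_pos.2 (by positivity)

theorem waterLevel_lt_coeffVar (hσ : 0 < σ) (hx : 1 < x) {n k : ℕ} (hk : k < n) :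
    waterLevel σ x n < coeffVar σ x k := by
  have h0 := (arcoth_spec hx).1
  have hk' : (k : ℝ) + 1 ≤ n := by exact_mod_cast hk
  rw [← NNReal.coe_lt_coe, coe_coeffVar, coe_waterLevel]
  have hlt : (2 * k + 1) * arcoth x < 2 * (n * arcoth x) := by nlinarith
  exact mul_lt_mul_of_pos_left (Real.exp_lt_exp.2 (neg_lt_neg hlt)) (by positivity)

theorem coeffVar_add_div_waterLevel (hσ : 0 < σ) (n j : ℕ) :
    (coeffVar σ x (n + j) : ℝ) / waterLevel σ x n = Real.exp (-((2 * j + 1) * arcoth x)) := by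
  rw [coe_coeffVar, coe_waterLevel, mul_div_mul_left _ _ (by positivity), ← Real.exp_sub]
  congr 1
  push_cast
  ring

theorem coeffVar_add_le_waterLevel (hσ : 0 < σ) (hx : 1 < x) (n j : ℕ) :
    (coeffVar σ x (n + j) : ℝ) ≤ waterLevel σ x n := by
  have h0 := (arcoth_spec hx).1
  rw [← div_le_one (NNReal.coe_pos.2 (waterLevel_pos hσ n)), coeffVar_add_div_waterLevel hσ, Real.exp_le_one_iff]
  have : 0 ≤ (2 * (j : ℝ) + 1) * arcoth x := by positivity
  linarith

theorem log_coeffVar_div_waterLevel (hσ : 0 < σ) (n k : ℕ) :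
    Real.log (coeffVar σ x k / waterLevel σ x n) =
      (2 * n - (2 * k + 1)) * arcoth x := by
  rw [coe_coeffVar, coe_waterLevel, mul_div_mul_left _ _ (by positivity), ← Real.exp_sub,
    Real.log_exp]
  ring

theorem sum_half_log_coeffVar (hσ : 0 < σ) (n : ℕ) :
    ∑ k ∈ Finset.range n, 1 / 2 * Real.log (coeffVar σ x k / waterLevel σ x n) =
      n ^ 2 * arcoth x / 2 := by
  simp_rw [log_coeffVar_div_waterLevel hσ]
  have h : ∀ m : ℕ, ∑ k ∈ Finset.range m, 1 / 2 * ((2 * (n : ℝ) - (2 * k + 1)) * arcoth x) =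
      (2 * n * m - m ^ 2) * arcoth x / 2 := by
    intro m
    induction m with
    | zero => simp
    | succ m ih => rw [Finset.sum_range_succ, ih]; push_cast; ring
  rw [h]
  ring

/-- The distortion of reverse water-filling with `n` active coefficients. -/
theorem hasSum_min_waterLevel_coeffVar (hσ : 0 < σ) (hx : 1 < x) (n : ℕ) :
    HasSum (fun k => ((if k < n then waterLevel σ x n else coeffVar σ x k : ℝ≥0) : ℝ))
      (waterLevel σ x n * (n + 1 / (2 * Real.sinh (arcoth x)))) := by
  rw [← hasSum_nat_add_iff' n]
  have h := (hasSum_exp_odd_mul (arcoth_spec hx).1).mul_left (waterLevel σ x n : ℝ)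
  convert! h using 1
  · ext j
    rw [if_neg (by omega), ← coeffVar_add_div_waterLevel hσ n j, add_comm j n,
      mul_div_cancel₀ _ (NNReal.coe_ne_zero.2 (waterLevel_pos hσ n).ne')]
  · rw [Finset.sum_congr rfl fun k hk => by rw [if_pos (Finset.mem_range.1 hk)]]
    simp
    ring

/-- Achievability with `n` active coefficients. -/
theorem rateDistortion_coeffVar_le (hσ : 0 < σ) (hx : 1 < x) (n : ℕ) {D : ℝ}
    (hD : x / 2 * σ ^ 2 * wBase (n * arcoth x) ≤ D) :
    rateDistortion (Measure.infinitePi fun k => gaussianReal 0 (coeffVar σ x k)) D ≤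
      ENNReal.ofReal (n ^ 2 * arcoth x / 2) := by
  rw [← sum_half_log_coeffVar hσ]
  refine rateDistortion_le (waterLevel_pos hσ n) (fun k hk => waterLevel_lt_coeffVar hσ hx hk) ?_
  have hsum := hasSum_min_waterLevel_coeffVar hσ hx n
  simp_rw [← ENNReal.ofReal_coe_nnreal]
  rw [← ENNReal.ofReal_tsum_of_nonneg (fun _ => NNReal.coe_nonneg _) hsum.summable, hsum.tsum_eq]
  refine ENNReal.ofReal_le_ofReal (le_trans ?_ hD)
  rw [coe_waterLevel, wBase]
  have h1 : 1 / (2 * Real.sinh (arcoth x)) ≤ x / 2 := by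
    have := inv_sinh_arcoth_le hx
    rw [mul_comm, ← div_div]
    linarith
  have h2 : (n : ℝ) ≤ n * arcoth x * x := by
    have h3 := one_div_le_arcoth hx
    rw [div_le_iff₀ (by linarith)] at h3
    nlinarith [Nat.cast_nonneg (α := ℝ) n]
  calc σ ^ 2 * Real.exp (-(2 * (n * arcoth x))) * (n + 1 / (2 * Real.sinh (arcoth x)))
      ≤ σ ^ 2 * Real.exp (-(2 * (n * arcoth x))) * (n * arcoth x * x + x / 2) := by gcongr
    _ = _ := by ring

/-- Converse with the water level between the coefficients `n - 1` and `n`. -/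
theorem le_rateDistortion_coeffVar (hσ : 0 < σ) (hx : 1 < x) (n : ℕ) {D : ℝ} (hD : 0 ≤ D) :
    ENNReal.ofReal (n ^ 2 * arcoth x / 2 + n / 2 + 1 / (4 * Real.sinh (arcoth x)) -
        D / (2 * waterLevel σ x n)) ≤
      rateDistortion (Measure.infinitePi fun k => gaussianReal 0 (coeffVar σ x k)) D := by
  have hθ : (0 : ℝ) < waterLevel σ x n := waterLevel_pos hσ n
  have hlim := (((hasSum_exp_odd_mul (arcoth_spec hx).1).div_const 2).tendsto_sum_nat.const_add
    (n ^ 2 * arcoth x / 2 + n / 2)).sub_const (D / (2 * waterLevel σ x n))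
  have hlim' := (ENNReal.continuous_ofReal.tendsto _).comp hlim
  rw [show 1 / (2 * Real.sinh (arcoth x)) / 2 = 1 / (4 * Real.sinh (arcoth x)) by
    rw [div_div]; ring_nf] at hlim'
  -- Using the first `n + M` components; the last `M` contribute the partial sums of `hlim`.
  refine le_of_tendsto' hlim' fun M => ?_
  refine le_trans (le_of_eq ?_) (le_rateDistortion (v := coeffVar σ x)
    (waterLevel_pos (x := x) hσ n) hD
    (n + M))
  simp only [Function.comp]
  congr 2
  rw [Finset.sum_range_add]
  congr 1
  · rw [← sum_half_log_coeffVar hσ n, show (n : ℝ) / 2 = ∑ k ∈ Finset.range n, (1 / 2 : ℝ) by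
      simp; ring, ← Finset.sum_add_distrib]
    refine Finset.sum_congr rfl fun k hk => ?_
    have hlt : (waterLevel σ x n : ℝ) < coeffVar σ x k :=
      waterLevel_lt_coeffVar hσ hx (Finset.mem_range.1 hk)
    have : (coeffVar σ x k : ℝ) ≠ 0 := (hθ.trans hlt).ne'
    rw [max_eq_left hlt.le]
    congr 1
    field_simp
  · refine Finset.sum_congr rfl fun j _ => ?_
    rw [max_eq_right (coeffVar_add_le_waterLevel hσ hx n j), div_self hθ.ne', Real.log_one,
      ← coeffVar_add_div_waterLevel hσ n j, div_div]
    ring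

/-- The asymptotic formula for `D ≤ (x / 2) σ²`, with an error bound that is uniform in `w ≤ M`. -/
theorem rateDistortion_coeffVar_asymptotics (hσ : 0 < σ) (hx : 1 < x) {D w M : ℝ} (hw : 0 ≤ w)
    (hwM : w ≤ M) (hD : D = x / 2 * σ ^ 2 * wBase w) :
    rateDistortion (Measure.infinitePi fun k => gaussianReal 0 (coeffVar σ x k)) D ≠ ⊤ ∧
    |((rateDistortion (Measure.infinitePi fun k => gaussianReal 0 (coeffVar σ x k)) D).toReal -
      x / 2 * w ^ 2) / x| ≤
      (M + 1) * (1 / (x - 1)) + (1 / (x - 1)) ^ 2 + (M ^ 2 + M + 1) * (1 / x) := by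
  set δ := arcoth x with hδ
  have hδ0 : 0 < δ := (arcoth_spec hx).1
  have hx0 : 0 < x := by linarith
  have hδle : δ ≤ 1 / (x - 1) := arcoth_le_one_div hx
  have hδge : 1 ≤ δ * x := by
    have := one_div_le_arcoth hx
    rwa [div_le_iff₀ hx0] at this
  have hM : 0 ≤ M := hw.trans hwM
  have hD0 : 0 ≤ D := by rw [hD, wBase]; positivity
  set R := rateDistortion (Measure.infinitePi fun k => gaussianReal 0 (coeffVar σ x k)) D with hR
  -- Rounding `w / δ` up: `n δ ≥ w`, so `n` active coefficients suffice for the distortion `D`.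
  have hupper : R ≤ ENNReal.ofReal ((⌈w / δ⌉₊ : ℝ) ^ 2 * δ / 2) := by
    refine rateDistortion_coeffVar_le hσ hx _ ?_
    rw [hD]
    have h1 : w ≤ ⌈w / δ⌉₊ * δ := (div_le_iff₀ hδ0).1 (Nat.le_ceil _)
    have h2 := wBase_strictAntiOn.antitoneOn (Set.mem_Ici.2 hw) (Set.mem_Ici.2 (hw.trans h1)) h1
    gcongr
  have hRtop : R ≠ ⊤ := ne_top_of_le_ne_top ENNReal.ofReal_ne_top hupper
  have hup : R.toReal ≤ x / 2 * (w + δ) ^ 2 := by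
    refine (ENNReal.toReal_le_of_le_ofReal (by positivity) hupper).trans ?_
    have h1 : (⌈w / δ⌉₊ : ℝ) * δ ≤ w + δ := by
      have := (Nat.ceil_lt_add_one (div_nonneg hw hδ0.le)).le
      calc (⌈w / δ⌉₊ : ℝ) * δ ≤ (w / δ + 1) * δ := by gcongr
        _ = w + δ := by field_simp
    calc (⌈w / δ⌉₊ : ℝ) ^ 2 * δ / 2 = (⌈w / δ⌉₊ : ℝ) ^ 2 * δ * 1 / 2 := by ring
      _ ≤ (⌈w / δ⌉₊ : ℝ) ^ 2 * δ * (δ * x) / 2 := by gcongr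
      _ = x / 2 * (⌈w / δ⌉₊ * δ) ^ 2 := by ring
      _ ≤ x / 2 * (w + δ) ^ 2 := by gcongr
  -- Rounding `w / δ` down: `t = n δ ≤ w` keeps the loss term `D / (2 θ)` below `(x / 4) (2 w + 1)`.
  set n := ⌊w / δ⌋₊ with hn
  set t := n * δ with ht
  have ht0 : 0 ≤ t := by positivity
  have htw : t ≤ w := (le_div_iff₀ hδ0).1 (Nat.floor_le (div_nonneg hw hδ0.le))
  have hwt : w ≤ t + δ := by
    have := (Nat.lt_floor_add_one (w / δ)).le
    rw [div_le_iff₀ hδ0] at this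
    linarith
  have hlow : (x - 1) * (t ^ 2 + t) / 2 + (x - 1) / 4 - x / 4 * (2 * w + 1) ≤ R.toReal := by
    have h1 := le_rateDistortion_coeffVar hσ hx n hD0
    rw [← hR, ← hδ, ENNReal.ofReal_le_iff_le_toReal hRtop] at h1
    refine le_trans ?_ h1
    have h2 : (x - 1) * (t ^ 2 + t) / 2 ≤ n ^ 2 * δ / 2 + n / 2 := by
      have h3 : (x - 1) * δ ≤ 1 := by
        rw [le_div_iff₀ (by linarith)] at hδle
        linarith
      calc (x - 1) * (t ^ 2 + t) / 2 = (x - 1) * δ * (n ^ 2 * δ + n) / 2 := by rw [ht]; ring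
        _ ≤ 1 * (n ^ 2 * δ + n) / 2 := by gcongr
        _ = _ := by ring
    have h3 : (x - 1) / 4 ≤ 1 / (4 * Real.sinh δ) := by
      have := sub_one_le_inv_sinh_arcoth hx
      rw [mul_comm, ← div_div]
      linarith
    have h4 : D / (2 * waterLevel σ x n) ≤ x / 4 * (2 * w + 1) := by
      rw [coe_waterLevel, ← hδ, ← ht, hD, wBase, div_le_iff₀ (by positivity)]
      have h5 : Real.exp (-(2 * w)) ≤ Real.exp (-(2 * t)) := by gcongr
      calc x / 2 * σ ^ 2 * ((2 * w + 1) * Real.exp (-(2 * w)))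
          ≤ x / 2 * σ ^ 2 * ((2 * w + 1) * Real.exp (-(2 * t))) := by gcongr
        _ = _ := by ring
    linarith
  have hδ2 : δ ^ 2 ≤ (1 / (x - 1)) ^ 2 := by gcongr
  have hMδ : M * δ ≤ M * (1 / (x - 1)) := by gcongr
  have hε : 0 ≤ 1 / (x - 1) := hδ0.le.trans hδle
  have hq : 0 ≤ 1 / x := by positivity
  refine ⟨hRtop, abs_le.2 ⟨?_, ?_⟩⟩
  · rw [le_div_iff₀ hx0]
    have e1 : 1 / x * x = 1 := by field_simp
    have e2 : x * (w ^ 2 - t ^ 2) ≤ x * (2 * M * δ) := by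
      gcongr
      nlinarith
    have e3 : t ^ 2 ≤ M ^ 2 := by gcongr; linarith
    have e4 : x * (M * δ) ≤ x * (M * (1 / (x - 1))) := by gcongr
    have e5 : x * δ ≤ x * (1 / (x - 1)) := by gcongr
    have e6 : x * w ≤ x * (t + δ) := by gcongr
    have e7 : 0 ≤ x * (1 / (x - 1)) ^ 2 := by positivity
    have e8 : 0 ≤ x * (1 / (x - 1)) := by positivity
    have e9 : (M ^ 2 + M + 1) * (1 / x) * x = M ^ 2 + M + 1 := by field_simp
    have : -((M + 1) * (1 / (x - 1)) + (1 / (x - 1)) ^ 2 + (M ^ 2 + M + 1) * (1 / x)) * x =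
      -(x * (M * (1 / (x - 1))) + x * (1 / (x - 1)) + x * (1 / (x - 1)) ^ 2 +
        (M ^ 2 + M + 1) * (1 / x) * x) := by ring
    rw [this, e9]
    nlinarith
  · rw [div_le_iff₀ hx0]
    have e1 : w * δ ≤ M * (1 / (x - 1)) := by gcongr
    calc R.toReal - x / 2 * w ^ 2 ≤ (w * δ + δ ^ 2 / 2) * x := by linarith
      _ ≤ _ := by
        refine mul_le_mul_of_nonneg_right ?_ hx0.le
        have : 0 ≤ (M ^ 2 + M + 1) * (1 / x) := by positivity
        nlinarith [sq_nonneg δ]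

end Bounds

/-! ### The Hermite Gaussian process -/

theorem IsHermiteGaussianProcess.map_eq {Ω : Type*} [MeasurableSpace Ω] {P : Measure Ω}
    [IsProbabilityMeasure P] {σ α β : ℝ} {ξ : ℕ → Ω → ℝ} {X : ℝ → Ω → ℝ}
    (h : IsHermiteGaussianProcess P σ α β ξ X) :
    P.map (fun ω k => ξ k ω) =
      Measure.infinitePi fun k => gaussianReal 0 (coeffVar σ (α * β) k) := by
  rw [h.indep.map_fun_eq_infinitePi_map₀' fun k => (h.law k).aemeasurable]
  congr 1 with k : 1
  exact (h.law k).map_eq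

/-- The quotient `D x / x` is bounded below by a real number, chosen below the extended real
limit inferior. -/
theorem IsBigOmega.eventually_mul_le {D : ℝ → ℝ} (hD : IsBigOmega D fun x => x) :
    ∃ c : ℝ, 0 < c ∧ ∀ᶠ x in atTop, c * x ≤ D x := by
  obtain ⟨c, hc0, hc⟩ := EReal.lt_iff_exists_real_btwn.1 hD.2
  refine ⟨c, by exact_mod_cast hc0, ?_⟩
  filter_upwards [eventually_lt_of_lt_liminf hc, eventually_gt_atTop 0] with x hx hx0
  exact ((lt_div_iff₀ hx0).1 (by exact_mod_cast hx)).le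

end

theorem theorem3 (σ : ℝ) (hσ : 0 < σ)
    (α β : ℝ → ℝ) (hα : ∀ x, 1 < x → 0 < α x) (hβ : ∀ x, 1 < x → 0 < β x)
    (hαβ : ∀ x, 1 < x → α x * β x = x)
    {Ω : ℝ → Type*} [∀ x, MeasurableSpace (Ω x)]
    (P : (x : ℝ) → Measure (Ω x)) [∀ x, IsProbabilityMeasure (P x)]
    (ξ : (x : ℝ) → ℕ → Ω x → ℝ) (X : (x : ℝ) → ℝ → Ω x → ℝ)
    (hX : ∀ x, 1 < x → IsHermiteGaussianProcess (P x) σ (α x) (β x) (ξ x) (X x))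
    (D : ℝ → ℝ) (hD : IsBigOmega D (fun x => x)) :
    (∀ᶠ x in atTop, rateDistortion ((P x).map (fun ω k => ξ x k ω)) (D x) ≠ ⊤) ∧
    AsympEq
      (fun x => (rateDistortion ((P x).map (fun ω k => ξ x k ω)) (D x)).toReal)
      (fun x => if D x ≤ x / 2 * σ ^ 2
        then x / 2 * wNegOne (D x / (x / 2 * σ ^ 2)) ^ 2
        else 0) := by
  obtain ⟨c, hc0, hc⟩ := hD.eventually_mul_le
  have hmap : ∀ x, 1 < x → (P x).map (fun ω k => ξ x k ω) =
      Measure.infinitePi fun k => gaussianReal 0 (coeffVar σ x k) := fun x hx => by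
    rw [(hX x hx).map_eq, hαβ x hx]
  -- With no active coefficient the distortion is at most `(x / 2) σ²` and the rate is zero.
  have hzero : ∀ x, 1 < x → x / 2 * σ ^ 2 ≤ D x →
      rateDistortion ((P x).map (fun ω k => ξ x k ω)) (D x) = 0 := fun x hx hDx => by
    have h := rateDistortion_coeffVar_le hσ hx 0 (D := D x) (by simpa [wBase] using hDx)
    rw [hmap x hx]
    simpa using h
  have hpos : ∀ x, 1 < x → D x ≤ x / 2 * σ ^ 2 → c * x ≤ D x →
      D x / (x / 2 * σ ^ 2) ∈ Set.Ioc (0 : ℝ) 1 := fun x hx hDx hcx =>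
    ⟨div_pos (lt_of_lt_of_le (by positivity) hcx) (by positivity),
      (div_le_one (by positivity)).2 hDx⟩
  constructor
  · filter_upwards [hc, eventually_gt_atTop 1] with x hcx hx
    rcases le_total (D x) (x / 2 * σ ^ 2) with hDx | hDx
    · obtain ⟨hw0, hw⟩ := wNegOne_spec (hpos x hx hDx hcx)
      rw [hmap x hx]
      refine (rateDistortion_coeffVar_asymptotics hσ hx hw0 le_rfl ?_).1
      rw [wBase, hw, mul_div_cancel₀ _ (by positivity)]
    · rw [hzero x hx hDx]
      exact ENNReal.zero_ne_top
  · have hE : Tendsto (fun x : ℝ => (σ ^ 2 / (2 * c) + 1) * (1 / (x - 1)) + (1 / (x - 1)) ^ 2 +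
        ((σ ^ 2 / (2 * c)) ^ 2 + σ ^ 2 / (2 * c) + 1) * (1 / x)) atTop (𝓝 0) := by
      have h1 : Tendsto (fun x : ℝ => 1 / (x - 1)) atTop (𝓝 0) := by
        simp_rw [one_div]
        exact tendsto_inv_atTop_zero.comp (tendsto_atTop_add_const_right _ (-1) tendsto_id)
      have h2 : Tendsto (fun x : ℝ => 1 / x) atTop (𝓝 0) := by
        simp_rw [one_div]
        exact tendsto_inv_atTop_zero
      simpa using ((h1.const_mul (σ ^ 2 / (2 * c) + 1)).add (h1.pow 2)).add
        (h2.const_mul ((σ ^ 2 / (2 * c)) ^ 2 + σ ^ 2 / (2 * c) + 1))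
    refine squeeze_zero_norm' ?_ hE
    filter_upwards [hc, eventually_gt_atTop 1] with x hcx hx
    rw [Real.norm_eq_abs]
    have hx1 : 0 < x - 1 := by linarith
    split_ifs with hDx
    · have hm := hpos x hx hDx hcx
      obtain ⟨hw0, hw⟩ := wNegOne_spec hm
      rw [hmap x hx]
      refine (rateDistortion_coeffVar_asymptotics hσ hx hw0 ?_ ?_).2
      · -- `w * wBase w ≤ 1`, while `wBase w ≥ 2 c / σ²`.
        have h1 := mul_wBase_le_one hw0
        rw [wBase, hw] at h1
        have h2 : 2 * c / σ ^ 2 ≤ D x / (x / 2 * σ ^ 2) := by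
          rw [div_le_div_iff₀ (by positivity) (by positivity)]
          nlinarith [mul_le_mul_of_nonneg_right hcx (sq_nonneg σ)]
        have h3 := (mul_le_mul_of_nonneg_left h2 hw0).trans h1
        rw [mul_div_assoc', div_le_one (by positivity)] at h3
        rw [le_div_iff₀ (by positivity)]
        exact h3
      · rw [wBase, hw, mul_div_cancel₀ _ (by positivity)]
    · rw [hzero x hx (not_le.1 hDx).le]
      simp only [ENNReal.toReal_zero, sub_zero, zero_div, abs_zero]
      positivity
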